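/- For a complex matrix $M$, let $M^\dagger$ denote its Moore–Penrose inverse, $Q_M := M^\dagger M$, $M^*$ its conjugate transpose, and $\mathcal R(M)$, $\mathcal N(M)$ its range and null space. Let $A\in\mathbb C^{n\times n}$ have index $k\ge 1$, where the index is the smallest integer $k\ge 0$ with $\operatorname{rk}(A^k)=\operatorname{rk}(A^{k+1})$. Let $$A=U\begin{bmatrix}T&S\\0&N\end{bmatrix}U^*$$ be a core EP decomposition of $A$, i.e. $U\in\mathbb C^{n\times n}$ is unitary, $T\in\mathbb C^{t\times t}$ is nonsingular with $t=\operatorname{rk}(A^k)$, $S\in\mathbb C^{t\times(n-t)}$, and $N\in\mathbb C^{(n-t)\times(n-t)}$ is nilpotent of index $k$. Let $A^d$ be the Drazin inverse of $A$, that is, the unique $X$ with $XAX=X$, $AX=XA$, $XA^{k+1}=A^k$. Define the core EP inverse $A^{c}:=A^k(A^{k+1})^\dagger$, the WG (weak group) inverse $A^{w}:=(A^{c})^2A$, the dual DMP inverse $A^{\dagger,d}:=Q_AA^d$, and the dual WC inverse $A^{\dagger,w}:=Q_AA^{w}$. Then the following conditions are equivalent: (a) $A$ is a dual $k$-WC matrix,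 i.e. $A^kA^{\dagger,w}=A^{\dagger,w}A^k$; (b) $A^mA^{\dagger,w}=A^{\dagger,w}A^m$ for all positive integers $m$; (c) $A^mA^{\dagger,w}=A^{\dagger,w}A^m$ for some positive integer $m$; (d) $A^{\dagger,w}=A^d$; (e) $A$ is both a WG matrix, i.e. $AA^{w}=A^{w}A$, and a dual $k$-DMP matrix, i.e. $A^kA^{\dagger,d}=A^{\dagger,d}A^k$; (f) $\mathcal R(N)\subseteq\mathcal N(S)$ and $\mathcal N(N)\subseteq\mathcal N(S)$; (g) $SN+TS(I_{n-t}-Q_N)=0$. -/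

import Mathlib

open scoped Matrix

namespace GenInv

section MoorePenrose

variable {m n : Type*} [Fintype m] [Fintype n]

/-- `X` satisfies the four Penrose equations for `A`. -/
structure IsMoorePenrose (A : Matrix m n ℂ) (X : Matrix n m ℂ) : Prop where
  inner : A * X * A = A
  outer : X * A * X = X
  herm_left : (A * X)ᴴ = A * X
  herm_right : (X * A)ᴴ = X * A

open scoped ComplexOrder in
theorem exists_isMoorePenrose (A : Matrix m n ℂ) : ∃ X, IsMoorePenrose A X := by
  classical
  have key : ∀ H : Matrix n n ℂ, H.IsHermitian →
      ∃ G : Matrix n n ℂ, H * G * H = H ∧ G * H * G = G ∧ Gᴴ = G ∧ G * H = H * G := by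
    intro H hH
    let V : Matrix n n ℂ := (hH.eigenvectorUnitary : Matrix n n ℂ)
    let D : Matrix n n ℂ := Matrix.diagonal (fun i => ((hH.eigenvalues i : ℝ) : ℂ))
    let E : Matrix n n ℂ := Matrix.diagonal (fun i => (((hH.eigenvalues i)⁻¹ : ℝ) : ℂ))
    have hV : Vᴴ * V = 1 := Unitary.coe_star_mul_self hH.eigenvectorUnitary
    have hHD : H = V * D * Vᴴ := by
      have h := hH.spectral_theorem
      rw [Unitary.conjStarAlgAut_apply] at h
      exact h
    have hmul : ∀ P Q : Matrix n n ℂ, (V * P * Vᴴ) * (V * Q * Vᴴ) = V * (P * Q) * Vᴴ := by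
      intro P Q
      calc (V * P * Vᴴ) * (V * Q * Vᴴ) = V * P * (Vᴴ * V) * Q * Vᴴ := by
            simp only [Matrix.mul_assoc]
        _ = V * (P * Q) * Vᴴ := by rw [hV, Matrix.mul_one]; simp only [Matrix.mul_assoc]
    refine ⟨V * E * Vᴴ, ?_, ?_, ?_, ?_⟩
    · conv_lhs => rw [hHD]
      rw [hmul, hmul]
      conv_rhs => rw [hHD]
      congr 2
      simp only [D, E, Matrix.diagonal_mul_diagonal]
      congr 1
      funext i
      by_cases h : hH.eigenvalues i = 0
      · simp [h]
      · push_cast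
        field_simp
    · rw [hHD, hmul, hmul]
      congr 2
      simp only [D, E, Matrix.diagonal_mul_diagonal]
      congr 1
      funext i
      by_cases h : hH.eigenvalues i = 0
      · simp [h]
      · push_cast
        field_simp
    · simp only [Matrix.conjTranspose_mul, Matrix.conjTranspose_conjTranspose, E,
        Matrix.diagonal_conjTranspose, Matrix.mul_assoc]
      congr 3
      funext i
      simp
    · rw [hHD, hmul, hmul]
      congr 2
      simp only [D, E, Matrix.diagonal_mul_diagonal, mul_comm]
  have hH : (Aᴴ * A).IsHermitian := Matrix.isHermitian_conjTranspose_mul_self A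
  obtain ⟨G, h1, h2, h3, h4⟩ := key (Aᴴ * A) hH
  have hA : A * (G * (Aᴴ * A)) = A := by
    have h0 : (A * (G * (Aᴴ * A)) - A)ᴴ * (A * (G * (Aᴴ * A)) - A) = 0 := by
      have e : Aᴴ * (A * (G * (Aᴴ * A)) - A) = 0 := by
        rw [Matrix.mul_sub, sub_eq_zero]
        simpa only [Matrix.mul_assoc] using h1
      have e2 : (A * (G * (Aᴴ * A)) - A)ᴴ = (G * (Aᴴ * A) - 1)ᴴ * Aᴴ := by
        rw [← Matrix.conjTranspose_mul, Matrix.mul_sub, Matrix.mul_one]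
      rw [e2, Matrix.mul_assoc, e, Matrix.mul_zero]
    exact sub_eq_zero.mp (Matrix.conjTranspose_mul_self_eq_zero.mp h0)
  refine ⟨G * Aᴴ, ?_, ?_, ?_, ?_⟩
  · simpa only [Matrix.mul_assoc] using hA
  · calc G * Aᴴ * A * (G * Aᴴ) = (G * (Aᴴ * A) * G) * Aᴴ := by simp only [Matrix.mul_assoc]
      _ = G * Aᴴ := by rw [h2]
  · simp only [Matrix.conjTranspose_mul, Matrix.conjTranspose_conjTranspose, h3, Matrix.mul_assoc]
  · have : G * Aᴴ * A = G * (Aᴴ * A) := Matrix.mul_assoc _ _ _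
    rw [this, Matrix.conjTranspose_mul, h3, hH.eq, h4]

theorem IsMoorePenrose.unique {A : Matrix m n ℂ} {X Y : Matrix n m ℂ}
    (hX : IsMoorePenrose A X) (hY : IsMoorePenrose A Y) : X = Y := by
  have h1 : A * X = A * Y := by
    calc A * X = (A * X)ᴴ := hX.herm_left.symm
      _ = ((A * Y) * (A * X))ᴴ := by
          rw [← Matrix.mul_assoc (A * Y) A X, hY.inner]
      _ = (A * X) * (A * Y) := by
          rw [Matrix.conjTranspose_mul, hX.herm_left, hY.herm_left]
      _ = A * Y := by rw [← Matrix.mul_assoc (A * X) A Y, hX.inner]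
  have h2 : X * A = Y * A := by
    calc X * A = (X * A)ᴴ := hX.herm_right.symm
      _ = ((X * A) * (Y * A))ᴴ := by
          rw [Matrix.mul_assoc X A (Y * A), ← Matrix.mul_assoc A Y A, hY.inner]
      _ = (Y * A) * (X * A) := by
          rw [Matrix.conjTranspose_mul, hX.herm_right, hY.herm_right]
      _ = Y * A := by rw [Matrix.mul_assoc Y A (X * A), ← Matrix.mul_assoc A X A, hX.inner]
  calc X = X * A * X := hX.outer.symm
    _ = Y * A * Y := by rw [h2, Matrix.mul_assoc, h1, ← Matrix.mul_assoc]
    _ = Y := hY.outer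

/-- The Moore-Penrose inverse `A†`: the unique solution of the four Penrose equations. -/
noncomputable def mpInv (A : Matrix m n ℂ) : Matrix n m ℂ :=
  Classical.choose (exists_isMoorePenrose A)

theorem mpInv_spec (A : Matrix m n ℂ) : IsMoorePenrose A (mpInv A) :=
  Classical.choose_spec (exists_isMoorePenrose A)

/-- The orthogonal projector `Q_A = A† A` onto the range of `Aᴴ`. -/
noncomputable def projQ (A : Matrix m n ℂ) : Matrix n n ℂ := mpInv A * A

end MoorePenrose

section Square

variable {n : Type*} [Fintype n] [DecidableEq n]

theorem exists_rank_pow_eq (A : Matrix n n ℂ) : ∃ k : ℕ, (A ^ k).rank = (A ^ (k + 1)).rank := by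
  by_contra! h
  have hlt : ∀ k : ℕ, (A ^ (k + 1)).rank < (A ^ k).rank := fun k =>
    lt_of_le_of_ne (by rw [pow_succ]; exact Matrix.rank_mul_le_left _ _) (h k).symm
  have hb : ∀ k : ℕ, (A ^ k).rank + k ≤ (A ^ 0).rank := by
    intro k
    induction k with
    | zero => simp
    | succ k ih => have := hlt k; omega
  have := hb ((A ^ 0).rank + 1)
  omega

open Classical in
/-- The index of `A`: the smallest `k ≥ 0` with `rk (A ^ k) = rk (A ^ (k + 1))`. -/
noncomputable def ind (A : Matrix n n ℂ) : ℕ := Nat.find (exists_rank_pow_eq A)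

open Classical in
theorem ind_spec (A : Matrix n n ℂ) : (A ^ ind A).rank = (A ^ (ind A + 1)).rank :=
  Nat.find_spec (exists_rank_pow_eq A)

/-- `X` satisfies the three equations of the Drazin inverse of `A`, where `k` is the index. -/
structure IsDrazin (A X : Matrix n n ℂ) : Prop where
  outer : X * A * X = X
  comm : A * X = X * A
  pow : X * A ^ (ind A + 1) = A ^ ind A

theorem exists_isDrazin (A : Matrix n n ℂ) : ∃ X, IsDrazin A X := by
  have key : ∀ (B : Matrix n n ℂ) (k : ℕ), (B ^ k).rank = (B ^ (k + 1)).rank →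
      ∃ Y, B ^ k = B ^ (k + (k + 1)) * Y := by
    intro B k hk
    have hle : LinearMap.range (B ^ (k + 1)).mulVecLin ≤ LinearMap.range (B ^ k).mulVecLin := by
      rw [pow_succ, Matrix.mulVecLin_mul]
      exact LinearMap.range_comp_le_range _ _
    have heq : LinearMap.range (B ^ (k + 1)).mulVecLin = LinearMap.range (B ^ k).mulVecLin :=
      Submodule.eq_of_le_of_finrank_eq hle hk.symm
    have hcol : ∀ j : n, ∃ y : n → ℂ, (B ^ (k + 1)).mulVec y = (B ^ k).col j := by
      intro j
      have : (B ^ k).col j ∈ LinearMap.range (B ^ (k + 1)).mulVecLin := by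
        rw [heq]
        exact ⟨Pi.single j 1, by simp⟩
      exact this
    choose y hy using hcol
    have h1 : B ^ k = B ^ (k + 1) * Matrix.of (fun i j => y j i) := by
      ext i j
      exact (congrFun (hy j) i).symm
    have h2 : ∀ j : ℕ, ∃ Y, B ^ k = B ^ (k + j) * Y := by
      intro j
      induction j with
      | zero => exact ⟨1, by simp⟩
      | succ j ih =>
        obtain ⟨Y, hY⟩ := ih
        refine ⟨Matrix.of (fun i j => y j i) * Y, ?_⟩
        calc B ^ k = B ^ j * B ^ k * Y := by rw [← pow_add, add_comm j k]; exact hY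
          _ = B ^ j * (B ^ (k + 1) * Matrix.of (fun i j => y j i)) * Y := by rw [← h1]
          _ = B ^ (k + (j + 1)) * (Matrix.of (fun i j => y j i) * Y) := by
              rw [show k + (j + 1) = j + (k + 1) by omega, pow_add B j (k + 1)]
              simp only [Matrix.mul_assoc]
    exact h2 (k + 1)
  set k := ind A with hkdef
  obtain ⟨P, hP⟩ := key A k (ind_spec A)
  obtain ⟨Q', hQ'⟩ := key Aᵀ k (by
    rw [← Matrix.transpose_pow, ← Matrix.transpose_pow, Matrix.rank_transpose,
      Matrix.rank_transpose]
    exact ind_spec A)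
  have hQ : A ^ k = Q'ᵀ * A ^ (k + (k + 1)) := by
    have := congrArg Matrix.transpose hQ'
    rwa [Matrix.transpose_mul, ← Matrix.transpose_pow, ← Matrix.transpose_pow,
      Matrix.transpose_transpose, Matrix.transpose_transpose] at this
  set Q := Q'ᵀ
  have hc : A ^ k * P = Q * A ^ k := by
    calc A ^ k * P = Q * A ^ (k + (k + 1)) * P := by rw [← hQ]
      _ = Q * A ^ k := by rw [Matrix.mul_assoc, ← hP]
  have hc' : A * (A ^ k * P) = A ^ k * P * A := by
    calc A * (A ^ k * P) = A * (Q * A ^ (k + (k + 1)) * P) := by rw [← hQ]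
      _ = A * Q * A ^ k := by rw [Matrix.mul_assoc, ← hP, Matrix.mul_assoc]
      _ = A * (A ^ k * P) := by rw [hc, Matrix.mul_assoc]
      _ = A ^ (k + 1) * P := by rw [pow_succ', Matrix.mul_assoc]
      _ = A ^ k * A * P := by rw [pow_succ]
      _ = Q * A ^ (k + (k + 1)) * A * P := by rw [← hQ]
      _ = Q * A * (A ^ (k + (k + 1)) * P) := by
          have : A ^ (k + (k + 1)) * A = A * A ^ (k + (k + 1)) := by rw [← pow_succ, pow_succ']
          rw [Matrix.mul_assoc Q, this]
          simp only [Matrix.mul_assoc]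
      _ = Q * (A * A ^ k) := by rw [← hP, Matrix.mul_assoc]
      _ = Q * A ^ k * A := by rw [← pow_succ', pow_succ, Matrix.mul_assoc]
      _ = A ^ k * P * A := by rw [hc]
  refine ⟨A ^ k * P, ?_, hc', ?_⟩
  · calc A ^ k * P * A * (A ^ k * P) = Q * (A ^ k * A * A ^ k) * P := by
          rw [hc]; nth_rewrite 2 [← hc]; simp only [Matrix.mul_assoc]
      _ = Q * A ^ (k + (k + 1)) * P := by
          rw [← pow_succ, ← pow_add, show k + 1 + k = k + (k + 1) by omega]
      _ = A ^ k * P := by rw [← hQ]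
  · rw [← hkdef, hc, Matrix.mul_assoc, ← pow_add, ← hQ]

theorem IsDrazin.unique {A X Y : Matrix n n ℂ} (hX : IsDrazin A X) (hY : IsDrazin A Y) :
    X = Y := by
  have hidem : ∀ Z : Matrix n n ℂ, IsDrazin A Z →
      A * Z = A ^ (ind A + 1) * Z ^ (ind A + 1) := by
    intro Z hZ
    have hi : IsIdempotentElem (A * Z) := by
      change A * Z * (A * Z) = A * Z
      rw [Matrix.mul_assoc, ← Matrix.mul_assoc Z, hZ.outer]
    rw [← Commute.mul_pow (show Commute A Z from hZ.comm), hi.pow_succ_eq]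
  have hcY : Commute A Y := hY.comm
  have hcX : Commute A X := hX.comm
  have h1 : A * X = A * Y * (A * X) := by
    have e : A * Y * A ^ (ind A + 1) = A ^ (ind A + 1) := by
      rw [Matrix.mul_assoc, hY.pow, ← pow_succ']
    rw [hidem X hX, ← Matrix.mul_assoc, e]
  have h2 : A * Y = A * Y * (A * X) := by
    have e : A ^ (ind A + 1) * (A * X) = A ^ (ind A + 1) := by
      have : A ^ (ind A + 1) * (A * X) = (A * X) * A ^ (ind A + 1) :=
        (((Commute.refl A).mul_right hcX).pow_left _).eq
      rw [this, Matrix.mul_assoc, hX.pow, ← pow_succ']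
    have e' : A * Y = Y ^ (ind A + 1) * A ^ (ind A + 1) := by
      rw [hidem Y hY]; exact (hcY.pow_pow _ _).eq
    rw [e', Matrix.mul_assoc, e]
  have h3 : A * X = A * Y := h1.trans h2.symm
  calc X = X * (A * X) := by rw [← Matrix.mul_assoc, hX.outer]
    _ = (A * X) * Y := by rw [h3, ← Matrix.mul_assoc, ← hX.comm, h3]
    _ = Y := by rw [h3, hY.comm, hY.outer]

/-- The Drazin inverse `A^d`: the unique solution of the three equations. -/
noncomputable def drazinInv (A : Matrix n n ℂ) : Matrix n n ℂ :=
  Classical.choose (exists_isDrazin A)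

theorem drazinInv_spec (A : Matrix n n ℂ) : IsDrazin A (drazinInv A) :=
  Classical.choose_spec (exists_isDrazin A)

/-- The core EP inverse `A^k (A^(k+1))†`, where `k` is the index of `A`. -/
noncomputable def coreEPInv (A : Matrix n n ℂ) : Matrix n n ℂ :=
  A ^ ind A * mpInv (A ^ (ind A + 1))

/-- The weak group (WG) inverse: the square of the core EP inverse, times `A`. -/
noncomputable def wgInv (A : Matrix n n ℂ) : Matrix n n ℂ := coreEPInv A ^ 2 * A

/-- The dual DMP inverse `Q_A A^d`. -/
noncomputable def dualDMPInv (A : Matrix n n ℂ) : Matrix n n ℂ := projQ A * drazinInv A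

/-- The dual WC inverse: `Q_A` times the WG inverse. -/
noncomputable def dualWCInv (A : Matrix n n ℂ) : Matrix n n ℂ := projQ A * wgInv A

/-- WG matrices: `A` commutes with its WG inverse. -/
def IsWG (A : Matrix n n ℂ) : Prop := A * wgInv A = wgInv A * A

/-- Dual `k`-DMP matrices: `A ^ k` commutes with the dual DMP inverse, `k` the index of `A`. -/
def IsDualKDMP (A : Matrix n n ℂ) : Prop :=
  A ^ ind A * dualDMPInv A = dualDMPInv A * A ^ ind A

/-- Dual `k`-WC matrices: `A ^ k` commutes with the dual WC inverse, `k` the index of `A`. -/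
def IsDualKWC (A : Matrix n n ℂ) : Prop :=
  A ^ ind A * dualWCInv A = dualWCInv A * A ^ ind A

end Square

/-- The `n × n` matrix with blocks `[T, S; 0, N]`, where `T` is `t × t`, `N` is `s × s`
and `t + s = n`. -/
def blockUpper {n t s : ℕ} (h : t + s = n) (T : Matrix (Fin t) (Fin t) ℂ)
    (S : Matrix (Fin t) (Fin s) ℂ) (N : Matrix (Fin s) (Fin s) ℂ) : Matrix (Fin n) (Fin n) ℂ :=
  Matrix.reindex (finSumFinEquiv.trans (finCongr h)) (finSumFinEquiv.trans (finCongr h))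
    (Matrix.fromBlocks T S 0 N)

/-- `A = U [T, S; 0, N] Uᴴ` is a core EP decomposition of `A`: `U` is unitary, `T` is nonsingular
of size `t = rk (A ^ k)`, and `N` is nilpotent of index `k`, where `k` is the index of `A`. -/
structure IsCoreEPDecomposition {n t s : ℕ} (h : t + s = n) (A U : Matrix (Fin n) (Fin n) ℂ)
    (T : Matrix (Fin t) (Fin t) ℂ) (S : Matrix (Fin t) (Fin s) ℂ)
    (N : Matrix (Fin s) (Fin s) ℂ) : Prop where
  unitary : U ∈ Matrix.unitaryGroup (Fin n) ℂ
  eq : A = U * blockUpper h T S N * Uᴴ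
  nonsingular : IsUnit T
  rank_eq : t = (A ^ ind A).rank
  nilpotent : IsNilpotent N
  nilpotent_index : nilpotencyClass N = ind A

end GenInv

/-! Let `E = A * drazinInv A` and `Q = projQ A`. Since `E` lies in the double commutant of every
power `A ^ j` with `ind A ≤ j`, a matrix `X` that commutes with such a power commutes with `E`. If
`X` is the dual WC inverse, then `E * X = wgInv A` and `X * E = Q * drazinInv A`; for the WG and the
dual DMP inverse one of the two products is `drazinInv A` instead. So commutation turns into
equations between `Q`, the WG inverse and the Drazin inverse, and (d) says that both halves of (e)
hold.

If `V` and `W` are the two column blocks of the unitary factor of the core EP decomposition, then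
the core EP inverse is `V T⁻¹ Vᴴ`, hence the WG inverse is `V T⁻² Vᴴ A`, which commutes with `A` iff
`S N = 0`. Moreover `Q` fixes the range of the Drazin inverse, which is that of `V`, iff
`ker A ≤ ker Vᴴ`, and this means `ker N ≤ ker S` by block elimination. -/

namespace GenInv

theorem commute_mul_of_commute_of_mul_mul_eq {M : Type*} [Semigroup M] {b c x : M}
    (hbc : Commute b c) (hb : b * c * b = b) (hx : Commute b x) : Commute (b * c) x := by
  have hb' : b * (b * c) = b := by rw [hbc.eq, ← mul_assoc, hb]
  have hcx : b * c * x = c * x * b := by rw [hbc.eq, mul_assoc, hx.eq, mul_assoc]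
  calc b * c * x = c * x * b * (b * c) := by rw [hcx, mul_assoc _ b, hb']
    _ = b * c * (x * b) * c := by rw [← hcx]; simp only [mul_assoc]
    _ = x * (b * c) := by rw [← hx.eq, ← mul_assoc _ b, hb, hx.eq, mul_assoc]

section RangeKer

variable {l m n R : Type*} [Fintype m] [Fintype n] [CommSemiring R]

theorem range_mulVecLin_le_ker_iff (S : Matrix l m R) (N : Matrix m n R) :
    LinearMap.range N.mulVecLin ≤ LinearMap.ker S.mulVecLin ↔ S * N = 0 := by
  classical
  rw [LinearMap.range_le_ker_iff, ← Matrix.mulVecLin_mul, ← Matrix.mulVecLin_zero]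
  exact Matrix.toLin'.injective.eq_iff

end RangeKer

section Projector

variable {l m n : Type*} [Fintype m] [Fintype n]

theorem mul_projQ (A : Matrix m n ℂ) : A * projQ A = A := by
  rw [projQ, ← Matrix.mul_assoc, (mpInv_spec A).inner]

theorem projQ_conjTranspose (A : Matrix m n ℂ) : (projQ A)ᴴ = projQ A :=
  (mpInv_spec A).herm_right

theorem projQ_mul_self (A : Matrix m n ℂ) : projQ A * projQ A = projQ A := by
  nth_rw 1 [projQ]
  rw [Matrix.mul_assoc, mul_projQ, projQ]

theorem ker_le_ker_mulVecLin_iff (S : Matrix l n ℂ) (N : Matrix m n ℂ) :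
    LinearMap.ker N.mulVecLin ≤ LinearMap.ker S.mulVecLin ↔ S * projQ N = S := by
  classical
  constructor <;> intro h
  · have hN : N * (1 - projQ N) = 0 := by rw [Matrix.mul_sub, Matrix.mul_one, mul_projQ, sub_self]
    have hS := (range_mulVecLin_le_ker_iff S _).mp
      (((range_mulVecLin_le_ker_iff N _).mpr hN).trans h)
    rwa [Matrix.mul_sub, Matrix.mul_one, sub_eq_zero, eq_comm] at hS
  · rw [← h, projQ, ← Matrix.mul_assoc, Matrix.mulVecLin_mul]
    exact LinearMap.ker_le_ker_comp _ _

theorem mul_add_mul_mul_one_sub_projQ_eq_zero_iff [Fintype l] [DecidableEq l] [DecidableEq n]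
    {T : Matrix l l ℂ} (hT : IsUnit T) (S : Matrix l n ℂ) (N : Matrix n n ℂ) :
    S * N + T * S * (1 - projQ N) = 0 ↔ S * N = 0 ∧ S * projQ N = S := by
  constructor
  · intro h
    have hSN : S * N = 0 := by
      calc S * N = (S * N + T * S * (1 - projQ N)) * projQ N := by
            rw [Matrix.add_mul, Matrix.mul_assoc _ N, mul_projQ, Matrix.mul_assoc _ (1 - _),
              Matrix.sub_mul, projQ_mul_self, Matrix.one_mul, sub_self, Matrix.mul_zero, add_zero]
        _ = 0 := by rw [h, Matrix.zero_mul]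
    have := hT.invertible
    rw [hSN, zero_add, Matrix.mul_assoc, ← Matrix.mul_zero T,
      Matrix.mul_right_inj_of_invertible, Matrix.mul_sub, Matrix.mul_one, sub_eq_zero] at h
    exact ⟨hSN, h.symm⟩
  · rintro ⟨hSN, hSQ⟩
    rw [hSN, Matrix.mul_assoc, Matrix.mul_sub, Matrix.mul_one, hSQ, sub_self, Matrix.mul_zero,
      add_zero]

end Projector

section Drazin

variable {n : Type*} [Fintype n] [DecidableEq n] (A : Matrix n n ℂ)

theorem commute_drazinInv : Commute A (drazinInv A) := (drazinInv_spec A).comm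

theorem drazinInv_mul_mul_drazinInv : drazinInv A * (A * drazinInv A) = drazinInv A := by
  rw [← mul_assoc, (drazinInv_spec A).outer]

theorem mul_drazinInv_mul_drazinInv : A * drazinInv A * drazinInv A = drazinInv A := by
  rw [(commute_drazinInv A).eq, mul_assoc, drazinInv_mul_mul_drazinInv]

theorem isIdempotentElem_mul_drazinInv : IsIdempotentElem (A * drazinInv A) := by
  rw [IsIdempotentElem, mul_assoc, drazinInv_mul_mul_drazinInv]

variable {A} {j : ℕ}

theorem mul_drazinInv_mul_pow (hj : ind A ≤ j) : A * drazinInv A * A ^ j = A ^ j := by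
  rw [(commute_drazinInv A).eq, ← Nat.add_sub_cancel' hj, pow_add, mul_assoc, ← mul_assoc A,
    ← pow_succ', ← mul_assoc, (drazinInv_spec A).pow]

theorem pow_mul_drazinInv_pow (hj : ind A ≤ j) : A ^ j * drazinInv A ^ j = A * drazinInv A := by
  calc A ^ j * drazinInv A ^ j = A * drazinInv A * (A * drazinInv A) ^ j := by
        rw [(commute_drazinInv A).mul_pow, ← mul_assoc, mul_drazinInv_mul_pow hj]
    _ = A * drazinInv A := by rw [← pow_succ', (isIdempotentElem_mul_drazinInv A).pow_succ_eq]

theorem pow_mul_drazinInv_pow_succ (hj : ind A ≤ j) :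
    A ^ j * drazinInv A ^ (j + 1) = drazinInv A := by
  rw [pow_succ, ← mul_assoc, pow_mul_drazinInv_pow hj, mul_drazinInv_mul_drazinInv]

theorem commute_mul_drazinInv_of_commute_pow (hj : ind A ≤ j) {X : Matrix n n ℂ}
    (h : Commute (A ^ j) X) : Commute (A * drazinInv A) X := by
  rw [← pow_mul_drazinInv_pow hj]
  refine commute_mul_of_commute_of_mul_mul_eq ((commute_drazinInv A).pow_pow j j) ?_ h
  rw [pow_mul_drazinInv_pow hj, mul_drazinInv_mul_pow hj]

end Drazin

section WeakGroup

variable {n : Type*} [Fintype n] [DecidableEq n] (A : Matrix n n ℂ)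

theorem mul_drazinInv_mul_coreEPInv : A * drazinInv A * coreEPInv A = coreEPInv A := by
  rw [coreEPInv, ← mul_assoc, mul_drazinInv_mul_pow le_rfl]

theorem coreEPInv_mul_mul_drazinInv : coreEPInv A * (A * drazinInv A) = drazinInv A := by
  have hpow : coreEPInv A * A ^ (ind A + 1) = A ^ ind A := by
    calc coreEPInv A * A ^ (ind A + 1)
        = drazinInv A * (A ^ (ind A + 1) * mpInv (A ^ (ind A + 1)) * A ^ (ind A + 1)) := by
          simp only [coreEPInv, ← mul_assoc, (drazinInv_spec A).pow]
      _ = A ^ ind A := by rw [(mpInv_spec _).inner, (drazinInv_spec A).pow]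
  rw [← pow_mul_drazinInv_pow (Nat.le_succ (ind A)), ← mul_assoc, hpow,
    pow_mul_drazinInv_pow_succ le_rfl]

theorem mul_coreEPInv_conjTranspose : (A * coreEPInv A)ᴴ = A * coreEPInv A := by
  rw [coreEPInv, ← mul_assoc, ← pow_succ', (mpInv_spec _).herm_left]

theorem mul_drazinInv_mul_wgInv : A * drazinInv A * wgInv A = wgInv A := by
  rw [wgInv, sq, ← mul_assoc, ← mul_assoc, mul_drazinInv_mul_coreEPInv]

theorem wgInv_mul_mul_drazinInv : wgInv A * (A * drazinInv A) = drazinInv A := by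
  calc wgInv A * (A * drazinInv A)
      = coreEPInv A * (coreEPInv A * (A * drazinInv A) * A) := by
        rw [wgInv, sq, mul_assoc _ A, ((Commute.refl A).mul_right (commute_drazinInv A)).eq]
        simp only [mul_assoc]
    _ = drazinInv A := by
        rw [coreEPInv_mul_mul_drazinInv, ← (commute_drazinInv A).eq, coreEPInv_mul_mul_drazinInv]

theorem mul_drazinInv_mul_projQ_mul (X : Matrix n n ℂ) :
    A * drazinInv A * (projQ A * X) = A * drazinInv A * X := by
  rw [(commute_drazinInv A).eq, mul_assoc, ← mul_assoc A, mul_projQ, ← mul_assoc]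

variable {A}

theorem isWG_iff_wgInv_eq_drazinInv : IsWG A ↔ wgInv A = drazinInv A := by
  refine ⟨fun h => ?_, fun h => by rw [IsWG, h, (commute_drazinInv A).eq]⟩
  have hE := commute_mul_drazinInv_of_commute_pow le_rfl (Commute.pow_left h (ind A))
  rw [← mul_drazinInv_mul_wgInv, hE.eq, wgInv_mul_mul_drazinInv]

theorem isDualKDMP_iff_projQ_mul_drazinInv_eq :
    IsDualKDMP A ↔ projQ A * drazinInv A = drazinInv A := by
  refine ⟨fun h => ?_, fun h => ?_⟩
  · have hE := commute_mul_drazinInv_of_commute_pow le_rfl h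
    calc projQ A * drazinInv A = dualDMPInv A * (A * drazinInv A) := by
          rw [dualDMPInv, mul_assoc, drazinInv_mul_mul_drazinInv]
      _ = A * drazinInv A * drazinInv A := by
          rw [← hE.eq, dualDMPInv, mul_drazinInv_mul_projQ_mul]
      _ = drazinInv A := mul_drazinInv_mul_drazinInv A
  · rw [IsDualKDMP, dualDMPInv, h, ((commute_drazinInv A).pow_left _).eq]

theorem dualWCInv_eq_drazinInv_iff : dualWCInv A = drazinInv A ↔ IsWG A ∧ IsDualKDMP A := by
  rw [isWG_iff_wgInv_eq_drazinInv, isDualKDMP_iff_projQ_mul_drazinInv_eq]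
  refine ⟨fun h => ?_, fun ⟨hW, hQ⟩ => by rw [dualWCInv, hW, hQ]⟩
  have hW : wgInv A = drazinInv A := by
    rw [← mul_drazinInv_mul_wgInv, ← mul_drazinInv_mul_projQ_mul, ← dualWCInv, h,
      mul_drazinInv_mul_drazinInv]
  exact ⟨hW, by rw [← hW, ← dualWCInv, h, hW]⟩

theorem dualWCInv_eq_drazinInv_of_commute_pow {j : ℕ} (hj : ind A ≤ j)
    (h : Commute (A ^ j) (dualWCInv A)) : dualWCInv A = drazinInv A := by
  have hE := commute_mul_drazinInv_of_commute_pow hj h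
  have hQD : projQ A * drazinInv A = wgInv A := by
    calc projQ A * drazinInv A = dualWCInv A * (A * drazinInv A) := by
          rw [dualWCInv, mul_assoc, wgInv_mul_mul_drazinInv]
      _ = wgInv A := by
          rw [← hE.eq, dualWCInv, mul_drazinInv_mul_projQ_mul, mul_drazinInv_mul_wgInv]
  have hX : dualWCInv A = wgInv A := by
    rw [dualWCInv, ← hQD, ← mul_assoc, projQ_mul_self]
  rw [hX] at hE ⊢
  rw [← mul_drazinInv_mul_wgInv, hE.eq, wgInv_mul_mul_drazinInv]

end WeakGroup

/-- A core EP decomposition `A = U [T, S; 0, N] Uᴴ` over arbitrary finite index types, with the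
unitary factor `U = [V, W]` given by its two column blocks. Rows and columns of `U` have different
index types, so unitarity is stated as two equations. -/
structure IsCoreEPForm {n p q : Type*} [Fintype n] [DecidableEq n] [Fintype p] [DecidableEq p]
    [Fintype q] [DecidableEq q] (A : Matrix n n ℂ) (V : Matrix n p ℂ) (W : Matrix n q ℂ)
    (T : Matrix p p ℂ) (S : Matrix p q ℂ) (N : Matrix q q ℂ) : Prop where
  isometry : (Matrix.fromCols V W)ᴴ * Matrix.fromCols V W = 1
  coisometry : Matrix.fromCols V W * (Matrix.fromCols V W)ᴴ = 1
  eq : A = Matrix.fromCols V W * Matrix.fromBlocks T S 0 N * (Matrix.fromCols V W)ᴴ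
  nonsingular : IsUnit T
  nilpotent : IsNilpotent N

namespace IsCoreEPForm

variable {n p q : Type*} [Fintype n] [DecidableEq n] [Fintype p] [DecidableEq p]
  [Fintype q] [DecidableEq q] {A : Matrix n n ℂ} {V : Matrix n p ℂ} {W : Matrix n q ℂ}
  {T : Matrix p p ℂ} {S : Matrix p q ℂ} {N : Matrix q q ℂ} (h : IsCoreEPForm A V W T S N)

include h

theorem orthonormal : Vᴴ * V = 1 ∧ Vᴴ * W = 0 ∧ Wᴴ * V = 0 ∧ Wᴴ * W = 1 := by
  rw [← Matrix.fromBlocks_inj, Matrix.fromBlocks_one, ← Matrix.fromRows_mul_fromCols,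
    ← Matrix.conjTranspose_fromCols_eq_fromRows_conjTranspose, h.isometry]

theorem resolution_of_identity : V * Vᴴ + W * Wᴴ = 1 := by
  rw [← Matrix.fromCols_mul_fromRows, ← Matrix.conjTranspose_fromCols_eq_fromRows_conjTranspose,
    h.coisometry]

theorem inv_mul : T⁻¹ * T = 1 :=
  Matrix.nonsing_inv_mul T ((Matrix.isUnit_iff_isUnit_det T).mp h.nonsingular)

theorem mul_inv : T * T⁻¹ = 1 :=
  Matrix.mul_nonsing_inv T ((Matrix.isUnit_iff_isUnit_det T).mp h.nonsingular)

theorem mul_left_and_mul_right : A * V = V * T ∧ A * W = V * S + W * N := by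
  have hAU : A * Matrix.fromCols V W = Matrix.fromCols V W * Matrix.fromBlocks T S 0 N := by
    conv_lhs => rw [h.eq, Matrix.mul_assoc, h.isometry, Matrix.mul_one]
  rw [Matrix.mul_fromCols, Matrix.fromCols_mul_fromBlocks, Matrix.mul_zero, add_zero] at hAU
  exact Matrix.fromCols_inj hAU

theorem left_mul_and_right_mul : Vᴴ * A = T * Vᴴ + S * Wᴴ ∧ Wᴴ * A = N * Wᴴ := by
  have hUA : (Matrix.fromCols V W)ᴴ * A =
      Matrix.fromBlocks T S 0 N * (Matrix.fromCols V W)ᴴ := by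
    conv_lhs => rw [h.eq, ← Matrix.mul_assoc, ← Matrix.mul_assoc, h.isometry, Matrix.one_mul]
  rw [Matrix.conjTranspose_fromCols_eq_fromRows_conjTranspose, Matrix.fromRows_mul,
    Matrix.fromBlocks_mul_fromRows, Matrix.zero_mul, zero_add] at hUA
  exact Matrix.fromRows_inj hUA

theorem pow_mul_left (j : ℕ) : A ^ j * V = V * T ^ j := by
  induction j with
  | zero => simp only [pow_zero, Matrix.one_mul, Matrix.mul_one]
  | succ j ih =>
    rw [pow_succ, Matrix.mul_assoc, h.mul_left_and_mul_right.1, ← Matrix.mul_assoc, ih,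
      Matrix.mul_assoc, ← pow_succ]

theorem right_mul_pow (j : ℕ) : Wᴴ * A ^ j = N ^ j * Wᴴ := by
  induction j with
  | zero => simp only [pow_zero, Matrix.one_mul, Matrix.mul_one]
  | succ j ih =>
    rw [pow_succ', ← Matrix.mul_assoc, h.left_mul_and_right_mul.2, Matrix.mul_assoc, ih,
      ← Matrix.mul_assoc, ← pow_succ']

theorem drazinInv_mul_left : drazinInv A * V = V * T⁻¹ := by
  have := (h.nonsingular.pow (ind A + 1)).invertible
  rw [← Matrix.mul_left_inj_of_invertible (T ^ (ind A + 1)), Matrix.mul_assoc,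
    ← h.pow_mul_left, ← Matrix.mul_assoc, (drazinInv_spec A).pow, h.pow_mul_left,
    Matrix.mul_assoc, pow_succ', ← Matrix.mul_assoc T⁻¹, h.inv_mul, Matrix.one_mul]

theorem mul_drazinInv_mul_left : A * drazinInv A * V = V := by
  rw [Matrix.mul_assoc, h.drazinInv_mul_left, ← Matrix.mul_assoc, h.mul_left_and_mul_right.1,
    Matrix.mul_assoc, h.mul_inv, Matrix.mul_one]

theorem left_mul_conjTranspose_mul_mul_drazinInv :
    V * Vᴴ * (A * drazinInv A) = A * drazinInv A := by
  obtain ⟨m, hm⟩ := h.nilpotent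
  have hW : Wᴴ * (A * drazinInv A) = 0 := by
    rw [← pow_mul_drazinInv_pow (Nat.le_add_left (ind A) m), ← Matrix.mul_assoc, h.right_mul_pow,
      pow_add, hm, zero_mul, Matrix.zero_mul, Matrix.zero_mul]
  calc V * Vᴴ * (A * drazinInv A) = (V * Vᴴ + W * Wᴴ) * (A * drazinInv A) := by
        rw [Matrix.add_mul, Matrix.mul_assoc W, hW, Matrix.mul_zero, add_zero]
    _ = A * drazinInv A := by rw [h.resolution_of_identity, Matrix.one_mul]

theorem mul_coreEPInv_eq : A * coreEPInv A = V * Vᴴ := by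
  have hV : A * coreEPInv A * V = V := by
    rw [← h.mul_drazinInv_mul_left, ← Matrix.mul_assoc, mul_assoc A, coreEPInv_mul_mul_drazinInv]
  have hP : V * Vᴴ * (A * coreEPInv A) = A * coreEPInv A := by
    have hEP : A * drazinInv A * (A * coreEPInv A) = A * coreEPInv A := by
      rw [← mul_assoc, mul_assoc A, ← (commute_drazinInv A).eq, mul_assoc A,
        mul_drazinInv_mul_coreEPInv]
    rw [← hEP, ← mul_assoc, h.left_mul_conjTranspose_mul_mul_drazinInv]
  calc A * coreEPInv A = (V * Vᴴ * (A * coreEPInv A))ᴴ := by rw [hP, mul_coreEPInv_conjTranspose]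
    _ = A * coreEPInv A * V * Vᴴ := by
        rw [Matrix.conjTranspose_mul, mul_coreEPInv_conjTranspose, Matrix.conjTranspose_mul,
          Matrix.conjTranspose_conjTranspose, Matrix.mul_assoc _ V]
    _ = V * Vᴴ := by rw [hV]

theorem coreEPInv_eq : coreEPInv A = V * T⁻¹ * Vᴴ := by
  rw [← mul_drazinInv_mul_coreEPInv, (commute_drazinInv A).eq, mul_assoc, h.mul_coreEPInv_eq,
    ← Matrix.mul_assoc, h.drazinInv_mul_left]

theorem wgInv_eq : wgInv A = V * (T⁻¹ * T⁻¹) * (Vᴴ * A) := by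
  calc wgInv A = V * T⁻¹ * (Vᴴ * V) * T⁻¹ * (Vᴴ * A) := by
        rw [wgInv, sq, h.coreEPInv_eq]; simp only [Matrix.mul_assoc]
    _ = V * (T⁻¹ * T⁻¹) * (Vᴴ * A) := by
        rw [h.orthonormal.1, Matrix.mul_one, Matrix.mul_assoc V]

theorem isWG_iff : IsWG A ↔ S * N = 0 := by
  obtain ⟨hVV, -, -, hWW⟩ := h.orthonormal
  have hAW : A * wgInv A = V * (T⁻¹ * T⁻¹) * (T * (Vᴴ * A)) := by
    rw [h.wgInv_eq, ← Matrix.mul_assoc A, ← Matrix.mul_assoc A, h.mul_left_and_mul_right.1,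
      Matrix.mul_assoc V T, ← mul_assoc T, h.mul_inv, one_mul, ← Matrix.mul_assoc _ T,
      Matrix.mul_assoc V _ T, mul_assoc T⁻¹, h.inv_mul, mul_one]
  have hWA : wgInv A * A = A * wgInv A + V * (T⁻¹ * T⁻¹) * (S * N * Wᴴ) := by
    have hVAA : Vᴴ * A * A = T * (Vᴴ * A) + S * N * Wᴴ := by
      nth_rw 1 [h.left_mul_and_right_mul.1]
      rw [Matrix.add_mul, Matrix.mul_assoc T, Matrix.mul_assoc S, h.left_mul_and_right_mul.2,
        Matrix.mul_assoc S]
    rw [hAW, h.wgInv_eq, Matrix.mul_assoc _ (Vᴴ * A), hVAA, Matrix.mul_add]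
  rw [IsWG, hWA, left_eq_add]
  refine ⟨fun h0 => ?_, fun h0 => by rw [h0, Matrix.zero_mul, Matrix.mul_zero]⟩
  have hTT : T * T * (T⁻¹ * T⁻¹) = 1 := by
    rw [mul_assoc, ← mul_assoc T T⁻¹, h.mul_inv, one_mul, h.mul_inv]
  calc S * N = T * T * (Vᴴ * V) * (T⁻¹ * T⁻¹) * (S * N * (Wᴴ * W)) := by
        rw [hVV, hWW, Matrix.mul_one, Matrix.mul_one, hTT, Matrix.one_mul]
    _ = T * T * Vᴴ * (V * (T⁻¹ * T⁻¹) * (S * N * Wᴴ)) * W := by simp only [Matrix.mul_assoc]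
    _ = 0 := by rw [h0, Matrix.mul_zero, Matrix.zero_mul]

theorem projQ_mul_drazinInv_eq_iff :
    projQ A * drazinInv A = drazinInv A ↔ Vᴴ * projQ A = Vᴴ := by
  have hadj : Vᴴ * projQ A = Vᴴ ↔ projQ A * V = V := by
    rw [← Matrix.conjTranspose_inj, Matrix.conjTranspose_mul, projQ_conjTranspose,
      Matrix.conjTranspose_conjTranspose]
  rw [hadj]
  constructor <;> intro hQ
  · rw [← h.mul_drazinInv_mul_left, (commute_drazinInv A).eq, Matrix.mul_assoc,
      ← Matrix.mul_assoc, hQ]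
  · have hD : V * Vᴴ * drazinInv A = drazinInv A := by
      rw [← mul_drazinInv_mul_drazinInv, ← mul_assoc, h.left_mul_conjTranspose_mul_mul_drazinInv]
    rw [← hD, Matrix.mul_assoc V, ← Matrix.mul_assoc, hQ]

theorem ker_le_ker_conjTranspose_left_iff :
    LinearMap.ker A.mulVecLin ≤ LinearMap.ker Vᴴ.mulVecLin ↔
      LinearMap.ker N.mulVecLin ≤ LinearMap.ker S.mulVecLin := by
  obtain ⟨hVV, hVW, -, -⟩ := h.orthonormal
  obtain ⟨hAV, hAW⟩ := h.mul_left_and_mul_right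
  simp only [SetLike.le_def, LinearMap.mem_ker, Matrix.mulVecLin_apply]
  constructor
  · intro hker w hw
    let x := W *ᵥ w - V *ᵥ (T⁻¹ *ᵥ (S *ᵥ w))
    have hAx : A *ᵥ x = 0 := by
      rw [Matrix.mulVec_sub, Matrix.mulVec_mulVec, Matrix.mulVec_mulVec, hAW, hAV,
        Matrix.add_mulVec, ← Matrix.mulVec_mulVec w W N, hw, Matrix.mulVec_zero, add_zero,
        Matrix.mulVec_mulVec _ (V * T), Matrix.mul_assoc, h.mul_inv, Matrix.mul_one,
        Matrix.mulVec_mulVec, sub_self]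
    have hTSw : T⁻¹ *ᵥ (S *ᵥ w) = 0 := by
      have hVx : Vᴴ *ᵥ x = 0 := hker hAx
      rwa [Matrix.mulVec_sub, Matrix.mulVec_mulVec, Matrix.mulVec_mulVec, hVW, hVV,
        Matrix.zero_mulVec, Matrix.one_mulVec, zero_sub, neg_eq_zero] at hVx
    rw [← Matrix.one_mulVec (S *ᵥ w), ← h.mul_inv, ← Matrix.mulVec_mulVec, hTSw,
      Matrix.mulVec_zero]
  · intro hker x hx
    have hNW : N *ᵥ (Wᴴ *ᵥ x) = 0 := by
      rw [Matrix.mulVec_mulVec, ← h.left_mul_and_right_mul.2, ← Matrix.mulVec_mulVec, hx,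
        Matrix.mulVec_zero]
    have hTV : T *ᵥ (Vᴴ *ᵥ x) = 0 := by
      have hVA : (Vᴴ * A) *ᵥ x = 0 := by rw [← Matrix.mulVec_mulVec, hx, Matrix.mulVec_zero]
      rwa [h.left_mul_and_right_mul.1, Matrix.add_mulVec, ← Matrix.mulVec_mulVec,
        ← Matrix.mulVec_mulVec, hker hNW, add_zero] at hVA
    rw [← Matrix.one_mulVec (Vᴴ *ᵥ x), ← h.inv_mul, ← Matrix.mulVec_mulVec, hTV,
      Matrix.mulVec_zero]

theorem isDualKDMP_iff :
    IsDualKDMP A ↔ LinearMap.ker N.mulVecLin ≤ LinearMap.ker S.mulVecLin := by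
  rw [isDualKDMP_iff_projQ_mul_drazinInv_eq, h.projQ_mul_drazinInv_eq_iff,
    ← ker_le_ker_mulVecLin_iff, h.ker_le_ker_conjTranspose_left_iff]

end IsCoreEPForm

theorem IsCoreEPDecomposition.isCoreEPForm {n t s : ℕ} {hn : t + s = n}
    {A U : Matrix (Fin n) (Fin n) ℂ} {T : Matrix (Fin t) (Fin t) ℂ}
    {S : Matrix (Fin t) (Fin s) ℂ} {N : Matrix (Fin s) (Fin s) ℂ}
    (h : IsCoreEPDecomposition hn A U T S N) :
    IsCoreEPForm A (U.submatrix id (finSumFinEquiv.trans (finCongr hn))).toCols₁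
      (U.submatrix id (finSumFinEquiv.trans (finCongr hn))).toCols₂ T S N := by
  set e := finSumFinEquiv.trans (finCongr hn) with he
  have hB : Matrix.fromBlocks T S 0 N = (blockUpper hn T S N).submatrix e e := by
    simp [blockUpper, ← he]
  have hU : Uᴴ * U = 1 := Matrix.mem_unitaryGroup_iff'.mp h.unitary
  have hU' : U * Uᴴ = 1 := Matrix.mem_unitaryGroup_iff.mp h.unitary
  refine ⟨?_, ?_, ?_, h.nonsingular, h.nilpotent⟩ <;>
    rw [Matrix.fromCols_toCols, Matrix.conjTranspose_submatrix]
  · rw [← Matrix.submatrix_mul _ _ _ _ _ Function.bijective_id, hU,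
      Matrix.submatrix_one_equiv]
  · rw [← Matrix.submatrix_mul _ _ _ _ _ e.bijective, hU',
      Matrix.submatrix_id_id]
  · rw [hB, ← Matrix.submatrix_mul _ _ _ _ _ e.bijective,
      ← Matrix.submatrix_mul _ _ _ _ _ e.bijective, Matrix.submatrix_id_id]
    exact h.eq

end GenInv

open GenInv in
theorem theorem4p6_general {n p q : Type*} [Fintype n] [DecidableEq n] [Fintype p] [DecidableEq p]
    [Fintype q] [DecidableEq q] {A : Matrix n n ℂ} {V : Matrix n p ℂ} {W : Matrix n q ℂ}
    {T : Matrix p p ℂ} {S : Matrix p q ℂ} {N : Matrix q q ℂ} (h : IsCoreEPForm A V W T S N) :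
    List.TFAE [
      IsDualKWC A,
      ∀ m : ℕ, 1 ≤ m → A ^ m * dualWCInv A = dualWCInv A * A ^ m,
      ∃ m : ℕ, 1 ≤ m ∧ A ^ m * dualWCInv A = dualWCInv A * A ^ m,
      dualWCInv A = drazinInv A,
      IsWG A ∧ IsDualKDMP A,
      LinearMap.range N.mulVecLin ≤ LinearMap.ker S.mulVecLin ∧
        LinearMap.ker N.mulVecLin ≤ LinearMap.ker S.mulVecLin,
      S * N + T * S * (1 - projQ N) = 0] := by
  have hpow (hd : dualWCInv A = drazinInv A) (m : ℕ) : Commute (A ^ m) (dualWCInv A) :=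
    hd ▸ (commute_drazinInv A).pow_left m
  tfae_have 1 → 4 := dualWCInv_eq_drazinInv_of_commute_pow le_rfl
  tfae_have 4 → 1 := fun hd => hpow hd (ind A)
  tfae_have 4 → 2 := fun hd m _ => hpow hd m
  tfae_have 2 → 3 := fun hcomm => ⟨1, le_rfl, hcomm 1 le_rfl⟩
  tfae_have 3 → 4 := fun ⟨m, hm, hcomm⟩ =>
    dualWCInv_eq_drazinInv_of_commute_pow (Nat.le_mul_of_pos_left (ind A) hm)
      (pow_mul A m (ind A) ▸ Commute.pow_left hcomm (ind A))
  tfae_have 4 ↔ 5 := dualWCInv_eq_drazinInv_iff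
  tfae_have 5 ↔ 6 := by rw [h.isWG_iff, h.isDualKDMP_iff, range_mulVecLin_le_ker_iff]
  tfae_have 6 ↔ 7 := by
    rw [range_mulVecLin_le_ker_iff, ker_le_ker_mulVecLin_iff,
      mul_add_mul_mul_one_sub_projQ_eq_zero_iff h.nonsingular]
  tfae_finish

theorem theorem4p6 {n t s : ℕ} (hn : t + s = n)
    (A U : Matrix (Fin n) (Fin n) ℂ) (T : Matrix (Fin t) (Fin t) ℂ)
    (S : Matrix (Fin t) (Fin s) ℂ) (N : Matrix (Fin s) (Fin s) ℂ)
    (hk : 1 ≤ GenInv.ind A)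
    (hdec : GenInv.IsCoreEPDecomposition hn A U T S N) :
    List.TFAE [
      GenInv.IsDualKWC A,
      ∀ m : ℕ, 1 ≤ m → A ^ m * GenInv.dualWCInv A = GenInv.dualWCInv A * A ^ m,
      ∃ m : ℕ, 1 ≤ m ∧ A ^ m * GenInv.dualWCInv A = GenInv.dualWCInv A * A ^ m,
      GenInv.dualWCInv A = GenInv.drazinInv A,
      GenInv.IsWG A ∧ GenInv.IsDualKDMP A,
      LinearMap.range N.mulVecLin ≤ LinearMap.ker S.mulVecLin ∧
        LinearMap.ker N.mulVecLin ≤ LinearMap.ker S.mulVecLin,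
      S * N + T * S * (1 - GenInv.projQ N) = 0] :=
  theorem4p6_general hdec.isCoreEPForm
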